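/- Let $n\ge 0$ and $[1,n]=\{1,\dots,n\}$. For a finite sequence of numbers let $\mathrm{asc}(a_1,\dots,a_i)=|\{j<i : a_j<a_{j+1}\}|$. An \emph{ascent sequence} of length $n$ is a sequence $\alpha=(a_1,\dots,a_n)$ of non-negative integers with $a_1=0$ and $a_{i+1}\le 1+\mathrm{asc}(a_1,\dots,a_i)$ for $0<i<n$. Its run-length record $\mathrm{RLR}(\alpha)$ is the sequence of the lengths of its maximal runs of equal adjacent entries. Let $\mathrm{Mad}_n$ be the set of pairs $(\alpha,\chi)$ where $\alpha$ is an ascent sequence of length $n$ and $\chi=(X_1,\dots,X_\ell)$ is an ordered set partition of $[1,n]$ with $(|X_1|,\dots,|X_\ell|)=\mathrm{RLR}(\alpha)$. Let $\mathrm{Poset}_n$ be the set of $(2+2)$-free posets on $[1,n]$, that is, those with no induced subposet isomorphic to the disjoint union of two $2$-element chains. In a finite $(2+2)$-free poset $Q$ the distinct strict down-sets form a chain $D_0\subset D_1\subset\dots\subset D_{\ell(Q)}$. An element is on level $i$ if its strict down-set is $D_i$. Let $\ell^*(Q)$ be the lowest level that contains a maximal element. The Bousquet-M\'elou--Claesson--Dukes--Kitaev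 construction builds a poset from an ascent sequence $(a_1,\dots,a_n)$ as follows. It starts with one element; at each step $k\ge 2$ it adds an element $z$ to the present poset $Q$, with $i=a_k$: \begin{itemize} \item if $i\le\ell^*(Q)$, then $z$ is a new maximal element with strict down-set $D_i$; \item if $i=1+\ell(Q)$, then $z$ is placed above all elements of $Q$; \item if $\ell^*(Q)<i\le\ell(Q)$, then $z$ is a new maximal element with strict down-set $D_i$, and moreover every maximal element of $Q$ on a level below $i$ is put below every element of $Q$ on the levels $i,\dots,\ell(Q)$. \end{itemize} Define $\varphi(\alpha,\chi)$ by constructing the poset of $\alpha$ in this way and labelling the element inserted at step $i$ with the $i$-th letter of the word obtained by writing each of the blocks $X_1,\dots,X_\ell$ in increasing order and concatenating. For $P\in\mathrm{Poset}_n$ let $\pi(P)=(\alpha,\chi)$, where $\alpha$ is the ascent sequence whose constructed poset is isomorphic to $P$ (with its labels removed), and the $i$-th block of $\chi$ is the set of labels in $P$ that correspond, under an isomorphism, to the elements inserted during the $i$-th run of equal entries of $\alpha$. Then $\varphi$ is a bijection from $\mathrm{Mad}_n$ to $\mathrm{Poset}_n$. The map $\pi:\mathrm{Poset}_n\to\mathrm{Mad}_n$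 is well defined (there is exactly one such pair for each $P$, whatever the isomorphism), the blocks of $\pi(P)$ are the classes of indistinguishable elements of $P$ (elements with the same strict down-set and the same strict up-set), and $\pi$ is the inverse of $\varphi$. -/

import Mathlib

/-! ### Ascent sequences and runs -/

/-- `asc α i` is the number of ascents of the prefix of length `i` of the sequence `α`
(whose entries are indexed from `0`). -/
def asc {n : ℕ} (α : Fin n → ℕ) (i : ℕ) : ℕ :=
  Fintype.card {p : Fin n × Fin n //
    (p.1 : ℕ) + 1 = (p.2 : ℕ) ∧ (p.2 : ℕ) < i ∧ α p.1 < α p.2}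

/-- Ascent sequences: the first entry is `0`, and each later entry is at most one more than the
number of ascents of the prefix that precedes it. -/
def IsAscentSeq {n : ℕ} (α : Fin n → ℕ) : Prop :=
  ∀ i : Fin n, ((i : ℕ) = 0 → α i = 0) ∧ (0 < (i : ℕ) → α i ≤ 1 + asc α i)

/-- The positions `0, …, n - 1`, in this order, cut into the maximal runs of adjacent positions
at which `α` takes the same value. -/
def runs {n : ℕ} (α : Fin n → ℕ) : List (List (Fin n)) :=
  (List.finRange n).splitBy (fun i j => α i == α j)

/-- The run-length record of `α`. -/
def runLengthRecord {n : ℕ} (α : Fin n → ℕ) : List ℕ :=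
  (runs α).map List.length

/-! ### Levels of a finite poset, given by its strict order `lt` -/

/-- The strict down-set of `x`. -/
def downSet {Q : Type*} (lt : Q → Q → Prop) (x : Q) : Set Q := {y | lt y x}

/-- The level of `x`. In a `(2+2)`-free poset the distinct strict down-sets form a chain
`D₀ ⊂ D₁ ⊂ ⋯ ⊂ D_ℓ`, and `x` is on level `i` iff its strict down-set is `D_i`, i.e. iff exactly
`i` of the strict down-sets are properly contained in its own. -/
noncomputable def level {Q : Type*} (lt : Q → Q → Prop) (x : Q) : ℕ :=
  Set.ncard {D ∈ Set.range (downSet lt) | D ⊂ downSet lt x}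

/-- The highest level `ℓ`: one less than the number of distinct strict down-sets. -/
noncomputable def topLevel {Q : Type*} (lt : Q → Q → Prop) : ℕ :=
  Set.ncard (Set.range (downSet lt)) - 1

/-- `x` is a maximal element. -/
def IsMaxElt {Q : Type*} (lt : Q → Q → Prop) (x : Q) : Prop := ∀ y, ¬ lt x y

/-- The lowest level `ℓ*` that contains a maximal element. -/
noncomputable def minMaxLevel {Q : Type*} (lt : Q → Q → Prop) : ℕ :=
  sInf (level lt '' {x | IsMaxElt lt x})

/-! ### The Bousquet-Mélou–Claesson–Dukes–Kitaev construction -/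

/-- Adjoin to the elements `0, …, k - 1`, ordered by `lt`, a new maximal element `k` (that is,
`Fin.last k`) whose strict down-set is `D`. -/
def adjoin {k : ℕ} (lt : Fin k → Fin k → Prop) (D : Fin k → Prop) :
    Fin (k + 1) → Fin (k + 1) → Prop :=
  fun u v =>
    Fin.lastCases (motive := fun _ => Prop) False
      (fun x => Fin.lastCases (motive := fun _ => Prop) (D x) (fun y => lt x y) v) u

/-- The common strict down-set `D_i` of the elements on level `i`. -/
def levelDownSet {Q : Type*} (lt : Q → Q → Prop) (i : ℕ) (x : Q) : Prop :=
  ∃ y, level lt y = i ∧ lt x y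

/-- First rule: a new maximal element that covers the same elements as those on level `i`. -/
def add1 {k : ℕ} (lt : Fin k → Fin k → Prop) (i : ℕ) : Fin (k + 1) → Fin (k + 1) → Prop :=
  adjoin lt (levelDownSet lt i)

/-- Second rule: a new element that covers all maximal elements, and so lies above every
element. -/
def add2 {k : ℕ} (lt : Fin k → Fin k → Prop) : Fin (k + 1) → Fin (k + 1) → Prop :=
  adjoin lt (fun _ => True)

/-- Third rule: a new maximal element that covers the same elements as those on level `i`;
moreover all old maximal elements on levels below `i` are put below all old elements on
the levels `i` and higher. -/
def add3 {k : ℕ} (lt : Fin k → Fin k → Prop) (i : ℕ) : Fin (k + 1) → Fin (k + 1) → Prop :=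
  adjoin (fun x y => lt x y ∨ (IsMaxElt lt x ∧ level lt x < i ∧ i ≤ level lt y))
    (levelDownSet lt i)

open Classical in
/-- One step of the construction, with parameter `i` (where `0 ≤ i ≤ 1 + ℓ`): the first rule
applies if `i ≤ ℓ*`, the third if `ℓ* < i ≤ ℓ`, and the second if `i = 1 + ℓ`. -/
noncomputable def addElement {k : ℕ} (lt : Fin k → Fin k → Prop) (i : ℕ) :
    Fin (k + 1) → Fin (k + 1) → Prop :=
  if i ≤ minMaxLevel lt then add1 lt i
  else if i ≤ topLevel lt then add3 lt i
  else add2 lt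

/-- The strict order of the poset constructed from the sequence `α`. Its elements are
`0, …, n - 1`, element `j` being the one inserted at step `j + 1`. (On `Fin 1` this is the
one-element poset, whatever the rule applied.) -/
noncomputable def ascentPoset : (n : ℕ) → (Fin n → ℕ) → (Fin n → Fin n → Prop)
  | 0, _ => fun _ _ => False
  | k + 1, α => addElement (ascentPoset k (fun i => α i.castSucc)) (α (Fin.last k))

/-! ### `(2+2)`-free posets on a finite set `X`, given by their order relation -/

/-- There is no induced subposet isomorphic to the disjoint union of two `2`-element chains.
(The order `≤` on `Fin 2 ⊕ Fin 2` is that of the disjoint union.) -/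
def IsTwoPlusTwoFree {X : Type*} (r : X → X → Prop) : Prop :=
  IsEmpty (((· ≤ ·) : Fin 2 ⊕ Fin 2 → Fin 2 ⊕ Fin 2 → Prop) ↪r r)

/-- The `(2+2)`-free partial orders on `X`. -/
def TwoPlusTwoFreePosets (X : Type*) : Set (X → X → Prop) :=
  {r | IsPartialOrder X r ∧ IsTwoPlusTwoFree r}

/-- Two elements are indistinguishable if they have the same elements strictly above them and
the same elements strictly below them. -/
def Indistinguishable {X : Type*} (r : X → X → Prop) (x y : X) : Prop :=
  ∀ z, ((r x z ∧ x ≠ z) ↔ (r y z ∧ y ≠ z)) ∧ ((r z x ∧ z ≠ x) ↔ (r z y ∧ z ≠ y))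

/-! ### The set `Mad` and the two maps -/

/-- The ordered set partitions of `X` whose sequence of block sizes is `c`. -/
def orderedSetPartitions (X : Type*) (c : List ℕ) : Set (List (Finset X)) :=
  {χ | (∀ B ∈ χ, B.Nonempty) ∧ χ.Pairwise Disjoint ∧ (∀ x : X, ∃ B ∈ χ, x ∈ B) ∧
    χ.map Finset.card = c}

/-- The pairs of an ascent sequence `α` of length `n` and an ordered set partition of `X` whose
block sizes are given by the run-length record of `α`. -/
def Mad (n : ℕ) (X : Type*) : Set ((Fin n → ℕ) × List (Finset X)) :=
  {m | IsAscentSeq m.1 ∧ m.2 ∈ orderedSetPartitions X (runLengthRecord m.1)}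

/-- The word obtained by listing each block in increasing order and concatenating. -/
def blockWord {X : Type*} [LinearOrder X] (χ : List (Finset X)) : List X :=
  χ.flatMap (fun B => B.sort (· ≤ ·))

/-- The map `φ`: construct the poset of `α` element by element, and label the element inserted at
step `i` by the `i`-th letter of the word of `χ`. -/
def madMap {n : ℕ} {X : Type*} [LinearOrder X] (m : (Fin n → ℕ) × List (Finset X)) :
    X → X → Prop :=
  fun x y => x = y ∨ ∃ i j : Fin n,
    (blockWord m.2)[(i : ℕ)]? = some x ∧ (blockWord m.2)[(j : ℕ)]? = some y ∧
      ascentPoset n m.1 i j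

/-- The pair `m = (α, χ)` is read off from the order `r` on `X`: `α` is an ascent sequence
that corresponds to `r` with its labels removed (the poset constructed from `α` is isomorphic to
it), and the `i`-th entry of `χ` is the set of labels that correspond, under an
isomorphism `f`, to the elements inserted during the `i`-th run of `α`. -/
def ReadsOff {n : ℕ} {X : Type*} [LinearOrder X] (r : X → X → Prop)
    (m : (Fin n → ℕ) × List (Finset X)) : Prop :=
  IsAscentSeq m.1 ∧ ∃ f : Fin n ≃ X,
    (∀ i j, r (f i) (f j) ↔ (i = j ∨ ascentPoset n m.1 i j)) ∧
      m.2 = (runs m.1).map (fun l => (l.map f).toFinset)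

/-- The map `π`, which sends an order `r` to the pair that is read off from it. -/
noncomputable def readOff {n : ℕ} {X : Type*} [LinearOrder X] (r : X → X → Prop) :
    (Fin n → ℕ) × List (Finset X) :=
  Classical.epsilon (ReadsOff r)

/-! A (2+2)-free poset is an interval order. Give each element x the pair (a, b), where a is its
level and b is the index of the largest strict down-set that does not contain x. Then x < y iff the
second coordinate of x is less than the first coordinate of y. Every value 0, …, ℓ occurs in both
coordinates, so the multiset of pairs is an upper triangular matrix without zero rows or columns.
The pairs exist (`exists_isFishburnRep`) and depend only on the order (`IsFishburnRep.rep_unique`);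
hence the multiset determines the poset up to isomorphism, and conversely.

One step of the construction acts on multisets by `addPair` (`IsFishburnRep.addElement`). In the
result the parameter i reappears as ℓ*, and the step can be undone in exactly one way
(`IsFishburn.addPair_inj`, `IsFishburn.exists_addPair`). Throughout, ℓ is the number of ascents and
ℓ* the last entry, so the ascent condition allows exactly the parameters 0, …, ℓ + 1. Thus ascent
sequences of length n correspond to Fishburn multisets of size n, that is, to unlabelled posets.

For the labels, two inserted elements have the same pair iff they belong to the same run
(`ascentRep_eq_iff`), and equal pairs mean indistinguishable elements (`IsFishburnRep.eq_iff`). The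
blocks are therefore the fibres of the canonical pair map and do not depend on the isomorphism
(`toFinset_map_run`); the order of labels within a block is immaterial. -/

/-! ### Fishburn multisets -/

/-- A finite multiset of pairs `(a, b)` with `a ≤ b ≤ ℓ` whose first and whose second coordinates
exhaust `0, …, ℓ`; the number `s` is the least first coordinate of a pair with `b = ℓ`. -/
structure IsFishburn (S : Multiset (ℕ × ℕ)) (ℓ s : ℕ) : Prop where
  fst_le_snd : ∀ p ∈ S, p.1 ≤ p.2
  snd_le : ∀ p ∈ S, p.2 ≤ ℓ
  exists_fst : ∀ j ≤ ℓ, ∃ p ∈ S, p.1 = j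
  exists_snd : ∀ j ≤ ℓ, ∃ p ∈ S, p.2 = j
  mem : (s, ℓ) ∈ S
  le_fst : ∀ p ∈ S, p.2 = ℓ → s ≤ p.1

namespace IsFishburn

lemma exists_of {S : Multiset (ℕ × ℕ)} {ℓ : ℕ} (h₁ : ∀ p ∈ S, p.1 ≤ p.2)
    (h₂ : ∀ p ∈ S, p.2 ≤ ℓ) (h₃ : ∀ j ≤ ℓ, ∃ p ∈ S, p.1 = j) (h₄ : ∀ j ≤ ℓ, ∃ p ∈ S, p.2 = j) :
    ∃ s, IsFishburn S ℓ s := by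
  classical
  have h : ∃ a, (a, ℓ) ∈ S := by
    obtain ⟨p, hp, hpl⟩ := h₄ ℓ le_rfl
    exact ⟨p.1, by rw [← hpl]; exact hp⟩
  refine ⟨Nat.find h, h₁, h₂, h₃, h₄, Nat.find_spec h, fun p hp hpl => Nat.find_min' h ?_⟩
  rw [← hpl]; exact hp

variable {S : Multiset (ℕ × ℕ)} {ℓ s : ℕ}

lemma bot_le_top (h : IsFishburn S ℓ s) : s ≤ ℓ := h.fst_le_snd _ h.mem

lemma top_unique (h : IsFishburn S ℓ s) {ℓ' s' : ℕ} (h' : IsFishburn S ℓ' s') : ℓ = ℓ' :=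
  le_antisymm (h'.snd_le _ h.mem) (h.snd_le _ h'.mem)

lemma bot_unique (h : IsFishburn S ℓ s) {ℓ' s' : ℕ} (h' : IsFishburn S ℓ' s') : s = s' := by
  obtain rfl := h.top_unique h'
  exact le_antisymm (h.le_fst _ h'.mem rfl) (h'.le_fst _ h.mem rfl)

end IsFishburn

/-! ### One insertion step on multisets of pairs, and its inversion. -/

/-- The effect on the old pairs of adding an element with parameter `i`. -/
def pairShift (ℓ s i : ℕ) (p : ℕ × ℕ) : ℕ × ℕ :=
  if i ≤ s ∨ ℓ < i then p
  else (if p.1 < i then p.1 else p.1 + 1,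
    if p.2 = ℓ ∧ p.1 < i then i else if p.2 < i then p.2 else p.2 + 1)

/-- The new top level after adding an element with parameter `i`. -/
def nextTop (ℓ s i : ℕ) : ℕ := if i ≤ s then ℓ else ℓ + 1

/-- The pairs after adding an element with parameter `i`. -/
def addPair (ℓ s i : ℕ) (S : Multiset (ℕ × ℕ)) : Multiset (ℕ × ℕ) :=
  (i, nextTop ℓ s i) ::ₘ S.map (pairShift ℓ s i)

/-- A left inverse of `pairShift` in the case that relations among old elements are added. -/
def pairUnshift (ℓ i : ℕ) (p : ℕ × ℕ) : ℕ × ℕ :=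
  (if p.1 < i then p.1 else p.1 - 1, if p.2 < i then p.2 else if p.2 = i then ℓ else p.2 - 1)

/-- After the shift, second coordinate i occurs only for the old maximal elements on levels below i,
so it decodes to ℓ. -/
lemma pairUnshift_pairShift {ℓ s i : ℕ} (hs : s < i) (hi : i ≤ ℓ) {p : ℕ × ℕ}
    (hp : p.1 ≤ p.2) (hpl : p.2 ≤ ℓ) : pairUnshift ℓ i (pairShift ℓ s i p) = p := by
  obtain ⟨a, b⟩ := p
  have hc : ¬ (i ≤ s ∨ ℓ < i) := by omega
  simp only [pairUnshift, pairShift, if_neg hc] at *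
  ext <;> dsimp only <;> split_ifs <;> omega

lemma pairShift_injOn {ℓ s i : ℕ} {p q : ℕ × ℕ} (hp : p.1 ≤ p.2) (hpl : p.2 ≤ ℓ)
    (hq : q.1 ≤ q.2) (hql : q.2 ≤ ℓ) (h : pairShift ℓ s i p = pairShift ℓ s i q) : p = q := by
  by_cases hc : i ≤ s ∨ ℓ < i
  · simpa [pairShift, hc] using h
  · rw [← pairUnshift_pairShift (s := s) (i := i) (by omega) (by omega) hp hpl, h,
      pairUnshift_pairShift (by omega) (by omega) hq hql]

/-- Outside the first rule the new element is alone on its level; this tells the rules apart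
afterwards. -/
lemma pairShift_fst_ne {ℓ s i : ℕ} (hs : s < i) {p : ℕ × ℕ} (hp : p.1 ≤ ℓ) :
    (pairShift ℓ s i p).1 ≠ i := by
  unfold pairShift
  split_ifs <;> omega

lemma pairShift_eq_self {ℓ s i : ℕ} (h : i ≤ s ∨ ℓ < i) : pairShift ℓ s i = id := by
  ext p : 1
  simp [pairShift, h]

namespace IsFishburn

variable {S : Multiset (ℕ × ℕ)} {ℓ s i : ℕ}

/-- The new bottom is i: old pairs in the top column have first coordinate at least s ≥ i under the
first rule, are absent under the second, and under the third those below i have moved to column i.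
-/
lemma addPair (h : IsFishburn S ℓ s) (hi : i ≤ ℓ + 1) :
    IsFishburn (addPair ℓ s i S) (nextTop ℓ s i) i := by
  have hsl := h.bot_le_top
  by_cases h1 : i ≤ s
  · rw [_root_.addPair, pairShift_eq_self (.inl h1), Multiset.map_id, nextTop, if_pos h1]
    constructor
    · simpa using ⟨by omega, fun a b => h.fst_le_snd (a, b)⟩
    · simpa using fun a b => h.snd_le (a, b)
    · intro j hj
      obtain ⟨p, hp, rfl⟩ := h.exists_fst j hj
      exact ⟨p, by simp [hp], rfl⟩
    · intro j hj
      obtain ⟨p, hp, rfl⟩ := h.exists_snd j hj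
      exact ⟨p, by simp [hp], rfl⟩
    · simp
    · intro p hp hpl
      rcases Multiset.mem_cons.1 hp with rfl | hp
      · rfl
      · exact h1.trans (h.le_fst p hp hpl)
  · rw [_root_.addPair, nextTop, if_neg h1]
    by_cases h2 : ℓ < i
    · obtain rfl : i = ℓ + 1 := by omega
      rw [pairShift_eq_self (.inr h2), Multiset.map_id]
      constructor
      · simpa using fun a b => h.fst_le_snd (a, b)
      · simpa using fun a b hab => (h.snd_le (a, b) hab).trans (Nat.le_succ _)
      · intro j hj
        rcases hj.eq_or_lt with rfl | hj
        · exact ⟨_, Multiset.mem_cons_self _ _, rfl⟩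
        obtain ⟨p, hp, rfl⟩ := h.exists_fst j (by omega)
        exact ⟨p, by simp [hp], rfl⟩
      · intro j hj
        rcases hj.eq_or_lt with rfl | hj
        · exact ⟨_, Multiset.mem_cons_self _ _, rfl⟩
        obtain ⟨p, hp, rfl⟩ := h.exists_snd j (by omega)
        exact ⟨p, by simp [hp], rfl⟩
      · simp
      · intro p hp hpl
        rcases Multiset.mem_cons.1 hp with rfl | hp
        · rfl
        · have := h.snd_le p hp
          omega
    · have hc : ¬ (i ≤ s ∨ ℓ < i) := by omega
      have hcons : ∀ p ∈ S, pairShift ℓ s i p ∈ (i, ℓ + 1) ::ₘ S.map (pairShift ℓ s i) :=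
        fun p hp => Multiset.mem_cons_of_mem (Multiset.mem_map_of_mem _ hp)
      constructor
      · intro p hp
        simp only [Multiset.mem_cons, Multiset.mem_map] at hp
        rcases hp with rfl | ⟨q, hq, rfl⟩
        · dsimp only; omega
        · have := h.fst_le_snd q hq
          have := h.snd_le q hq
          simp only [pairShift, if_neg hc]
          split_ifs <;> omega
      · intro p hp
        simp only [Multiset.mem_cons, Multiset.mem_map] at hp
        rcases hp with rfl | ⟨q, hq, rfl⟩
        · exact le_rfl
        · have := h.snd_le q hq
          simp only [pairShift, if_neg hc]
          split_ifs <;> omega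
      · intro j hj
        rcases lt_trichotomy j i with hji | rfl | hji
        · obtain ⟨p, hp, rfl⟩ := h.exists_fst j (by omega)
          refine ⟨_, hcons p hp, ?_⟩
          simp [pairShift, hc, hji]
        · exact ⟨_, Multiset.mem_cons_self _ _, rfl⟩
        · obtain ⟨p, hp, hpj⟩ := h.exists_fst (j - 1) (by omega)
          refine ⟨_, hcons p hp, ?_⟩
          simp only [pairShift, if_neg hc]
          split_ifs <;> omega
      · intro j hj
        rcases lt_trichotomy j i with hji | rfl | hji
        · obtain ⟨p, hp, rfl⟩ := h.exists_snd j (by omega)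
          refine ⟨_, hcons p hp, ?_⟩
          simp only [pairShift, if_neg hc]
          split_ifs <;> omega
        -- Column i is filled by the old pair (s, ℓ), which moves to (s, i).
        · exact ⟨_, hcons _ h.mem, by simp [pairShift, hc, show s < j by omega]⟩
        · rcases hj.eq_or_lt with rfl | hj
          · exact ⟨_, Multiset.mem_cons_self _ _, rfl⟩
          obtain ⟨p, hp, hpj⟩ := h.exists_snd (j - 1) (by omega)
          refine ⟨_, hcons p hp, ?_⟩
          simp only [pairShift, if_neg hc]
          split_ifs <;> omega
      · simp
      · intro p hp hpl
        simp only [Multiset.mem_cons, Multiset.mem_map] at hp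
        rcases hp with rfl | ⟨q, hq, rfl⟩
        · exact le_rfl
        · have := h.snd_le q hq
          simp only [pairShift, if_neg hc] at hpl ⊢
          split_ifs at hpl ⊢ <;> omega

lemma exists_fst_eq_in_map_iff (h : IsFishburn S ℓ s) :
    (∃ p ∈ S.map (pairShift ℓ s i), p.1 = i) ↔ i ≤ s := by
  constructor
  · rintro ⟨p, hp, hpi⟩
    obtain ⟨q, hq, rfl⟩ := Multiset.mem_map.1 hp
    by_contra hi
    exact pairShift_fst_ne (by omega) ((h.fst_le_snd q hq).trans (h.snd_le q hq)) hpi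
  · intro hi
    rw [pairShift_eq_self (.inl hi), Multiset.map_id]
    exact h.exists_fst i (hi.trans h.bot_le_top)

/-- The result determines i as its bottom, then whether the first rule was used, then the old top
level; the shift is then undone. -/
lemma addPair_inj (h : IsFishburn S ℓ s) {S' : Multiset (ℕ × ℕ)} {ℓ' s' i' : ℕ}
    (h' : IsFishburn S' ℓ' s') (hi : i ≤ ℓ + 1) (hi' : i' ≤ ℓ' + 1)
    (he : _root_.addPair ℓ s i S = _root_.addPair ℓ' s' i' S') : i = i' ∧ S = S' := by
  have hf := h.addPair hi
  have hf' := h'.addPair hi'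
  rw [he] at hf
  obtain rfl := hf.bot_unique hf'
  refine ⟨rfl, ?_⟩
  have htop := hf.top_unique hf'
  rw [_root_.addPair, _root_.addPair, htop, Multiset.cons_inj_right] at he
  have hs : i ≤ s ↔ i ≤ s' := by
    rw [← h.exists_fst_eq_in_map_iff, ← h'.exists_fst_eq_in_map_iff, he]
  obtain rfl : ℓ = ℓ' := by
    unfold nextTop at htop
    split_ifs at htop <;> omega
  by_cases hc : i ≤ s ∨ ℓ < i
  · have hc' : i ≤ s' ∨ ℓ < i := by rwa [← hs]
    simpa [pairShift_eq_self hc, pairShift_eq_self hc'] using he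
  · have key : ∀ {T : Multiset (ℕ × ℕ)} {t : ℕ}, IsFishburn T ℓ t → t < i →
        (T.map (pairShift ℓ t i)).map (pairUnshift ℓ i) = T := by
      intro T t hT ht
      rw [Multiset.map_map]
      conv_rhs => rw [← Multiset.map_id T]
      exact Multiset.map_congr rfl fun p hp =>
        pairUnshift_pairShift ht (by omega) (hT.fst_le_snd p hp) (hT.snd_le p hp)
    rw [← key h (by omega), he, key h' (by omega)]

/-- Delete one copy of (s, ℓ). If row s stays nonempty, the first rule is undone; if it becomes
empty, s = ℓ gives the second rule and s < ℓ the third. -/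
lemma exists_addPair (h : IsFishburn S ℓ s) (hcard : 1 < S.card) :
    ∃ S' ℓ' s', IsFishburn S' ℓ' s' ∧ s ≤ ℓ' + 1 ∧ S = _root_.addPair ℓ' s' s S' := by
  obtain ⟨T, rfl⟩ := Multiset.exists_cons_of_mem h.mem
  have hsl := h.bot_le_top
  have hT : ∀ p ∈ T, p.1 ≤ p.2 ∧ p.2 ≤ ℓ ∧ (p.2 = ℓ → s ≤ p.1) := fun p hp =>
    ⟨h.fst_le_snd p (Multiset.mem_cons_of_mem hp), h.snd_le p (Multiset.mem_cons_of_mem hp),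
      h.le_fst p (Multiset.mem_cons_of_mem hp)⟩
  have hfst : ∀ j ≤ ℓ, j ≠ s → ∃ p ∈ T, p.1 = j := by
    intro j hj hjs
    obtain ⟨p, hp, rfl⟩ := h.exists_fst j hj
    rcases Multiset.mem_cons.1 hp with rfl | hp
    · exact absurd rfl hjs
    · exact ⟨p, hp, rfl⟩
  have hsnd : ∀ j < ℓ, ∃ p ∈ T, p.2 = j := by
    intro j hj
    obtain ⟨p, hp, rfl⟩ := h.exists_snd j hj.le
    rcases Multiset.mem_cons.1 hp with rfl | hp
    · exact absurd rfl hj.ne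
    · exact ⟨p, hp, rfl⟩
  by_cases h1 : ∃ p ∈ T, p.1 = s
  · obtain ⟨t, ht⟩ : ∃ t, IsFishburn T ℓ t := by
      refine IsFishburn.exists_of (fun p hp => (hT p hp).1) (fun p hp => (hT p hp).2.1) ?_ ?_
      · intro j hj
        by_cases hjs : j = s
        · subst hjs; exact h1
        · exact hfst j hj hjs
      · intro j hj
        rcases hj.eq_or_lt with rfl | hj
        -- A pair with first coordinate ℓ has second coordinate ℓ too, so a nonempty last row fills
        -- the last column.
        · have : ∃ p ∈ T, p.1 = j := by
            by_cases hjs : j = s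
            · subst hjs; exact h1
            · exact hfst j le_rfl hjs
          obtain ⟨p, hp, hpj⟩ := this
          exact ⟨p, hp, le_antisymm (hT p hp).2.1 (hpj ▸ (hT p hp).1)⟩
        · exact hsnd j hj
    have hst : s ≤ t := (hT _ ht.mem).2.2 rfl
    refine ⟨T, ℓ, t, ht, by omega, ?_⟩
    rw [_root_.addPair, pairShift_eq_self (.inl hst), Multiset.map_id, nextTop, if_pos hst]
  · push Not at h1
    -- For ℓ = 0 every remaining pair is (0, 0) and would lie in row s.
    have hl : 0 < ℓ := by
      by_contra h0
      have hT0 : 0 < T.card := by rw [Multiset.card_cons] at hcard; omega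
      obtain ⟨p, hp⟩ := Multiset.card_pos_iff_exists_mem.1 hT0
      have := hT p hp
      exact h1 p hp (by omega)
    obtain ⟨ℓ, rfl⟩ : ∃ k, ℓ = k + 1 := ⟨ℓ - 1, by omega⟩
    rcases hsl.eq_or_lt with rfl | hsl
    · obtain ⟨t, ht⟩ : ∃ t, IsFishburn T ℓ t := by
        refine IsFishburn.exists_of (fun p hp => (hT p hp).1) ?_ ?_ ?_
        · intro p hp
          have := hT p hp
          have := h1 p hp
          omega
        · exact fun j hj => hfst j (by omega) (by omega)
        · exact fun j hj => hsnd j (by omega)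
      have := ht.bot_le_top
      refine ⟨T, ℓ, t, ht, le_rfl, ?_⟩
      rw [_root_.addPair, pairShift_eq_self (.inr (by omega)), Multiset.map_id, nextTop,
        if_neg (by omega)]
    · have hmem : ∀ p ∈ T, pairUnshift ℓ s p ∈ T.map (pairUnshift ℓ s) :=
        fun p hp => Multiset.mem_map_of_mem _ hp
      obtain ⟨t, ht⟩ : ∃ t, IsFishburn (T.map (pairUnshift ℓ s)) ℓ t := by
        refine IsFishburn.exists_of ?_ ?_ ?_ ?_
        · intro p hp
          obtain ⟨q, hq, rfl⟩ := Multiset.mem_map.1 hp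
          have := hT q hq
          have := h1 q hq
          simp only [pairUnshift]
          split_ifs <;> omega
        · intro p hp
          obtain ⟨q, hq, rfl⟩ := Multiset.mem_map.1 hp
          have := hT q hq
          simp only [pairUnshift]
          split_ifs <;> omega
        · intro j hj
          by_cases hjs : j < s
          · obtain ⟨p, hp, rfl⟩ := hfst j (by omega) (by omega)
            exact ⟨_, hmem p hp, by simp [pairUnshift, hjs]⟩
          · obtain ⟨p, hp, hpj⟩ := hfst (j + 1) (by omega) (by omega)
            exact ⟨_, hmem p hp, by simp only [pairUnshift]; split_ifs <;> omega⟩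
        · intro j hj
          by_cases hjs : j < s
          · obtain ⟨p, hp, rfl⟩ := hsnd j (by omega)
            exact ⟨_, hmem p hp, by simp [pairUnshift, hjs]⟩
          · have : ∃ p ∈ T, p.2 = j + 1 := by
              rcases hj.eq_or_lt with rfl | hj
              · obtain ⟨p, hp, hpj⟩ := hfst (j + 1) le_rfl (by omega)
                have := hT p hp
                exact ⟨p, hp, by omega⟩
              · exact hsnd (j + 1) (by omega)
            obtain ⟨p, hp, hpj⟩ := this
            exact ⟨_, hmem p hp, by simp only [pairUnshift]; split_ifs <;> omega⟩
      -- Column s holds a pair outside row s, so its first coordinate is below s. Unshifting moves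
      -- it to the top column, hence the old bottom is below s and the first rule is excluded.
      have hts : t < s := by
        obtain ⟨p, hp, hps⟩ := hsnd s hsl
        have := ht.le_fst _ (hmem p hp) (by simp only [pairUnshift]; split_ifs <;> omega)
        have h1p := h1 p hp
        have hTp := hT p hp
        have h3 : p.1 < s := by omega
        simp only [pairUnshift, if_pos h3] at this
        omega
      refine ⟨_, ℓ, t, ht, by omega, ?_⟩
      rw [_root_.addPair, nextTop, if_neg (by omega), Multiset.map_map]
      congr 1
      conv_lhs => rw [← Multiset.map_id T]
      refine Multiset.map_congr rfl fun p hp => ?_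
      have := hT p hp
      have := h1 p hp
      obtain ⟨a, b⟩ := p
      simp only [Function.comp_apply, pairShift, pairUnshift, id] at *
      rw [if_neg (by omega)]
      ext <;> dsimp only <;> split_ifs <;> omega

end IsFishburn

/-! ### Representations of relations by Fishburn multisets -/

/-- The map `c` represents the relation `lt`: its values form a Fishburn multiset, and `x` is
below `y` iff the second coordinate of `x` is less than the first coordinate of `y`. -/
structure IsFishburnRep {Q : Type*} [Fintype Q] (lt : Q → Q → Prop) (c : Q → ℕ × ℕ)
    (ℓ s : ℕ) : Prop where
  fishburn : IsFishburn (Finset.univ.val.map c) ℓ s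
  lt_iff : ∀ x y, lt x y ↔ (c x).2 < (c y).1

lemma Multiset.map_univ_val_comp_equiv {X Y Z : Type*} [Fintype X] [Fintype Y] (e : X ≃ Y)
    (c : Y → Z) :
    (Finset.univ : Finset X).val.map (c ∘ e) = (Finset.univ : Finset Y).val.map c := by
  rw [← Multiset.map_map, ← Finset.map_univ_equiv e]
  rfl

/-- Fibres over each value have equal size and can be matched separately. This turns equality of
multisets into an isomorphism of posets. -/
lemma Multiset.exists_equiv_of_map_univ_val_eq {X Y Z : Type*} [Fintype X] [Fintype Y]
    [DecidableEq Z] {f : X → Z} {g : Y → Z}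
    (h : (Finset.univ : Finset X).val.map f = (Finset.univ : Finset Y).val.map g) :
    ∃ e : X ≃ Y, ∀ x, g (e x) = f x := by
  have key : ∀ z, Nonempty ({x // f x = z} ≃ {y // g y = z}) := by
    intro z
    rw [← Fintype.card_eq, Fintype.card_subtype, Fintype.card_subtype]
    have := congrArg (Multiset.count z) h
    rw [Multiset.count_map, Multiset.count_map] at this
    simp only [eq_comm (b := z), Finset.card, Finset.filter_val]
    simpa only [eq_comm (a := z)] using this
  exact ⟨Equiv.ofFiberEquiv fun z => (key z).some, fun x => Equiv.ofFiberEquiv_map _ _⟩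

namespace IsFishburnRep

variable {Q : Type*} [Fintype Q] {lt : Q → Q → Prop} {c : Q → ℕ × ℕ} {ℓ s : ℕ}

lemma fst_le_snd (h : IsFishburnRep lt c ℓ s) (x : Q) : (c x).1 ≤ (c x).2 :=
  h.fishburn.fst_le_snd _ (by simp)

lemma snd_le (h : IsFishburnRep lt c ℓ s) (x : Q) : (c x).2 ≤ ℓ :=
  h.fishburn.snd_le _ (by simp)

lemma fst_le (h : IsFishburnRep lt c ℓ s) (x : Q) : (c x).1 ≤ ℓ :=
  (h.fst_le_snd x).trans (h.snd_le x)

lemma exists_fst (h : IsFishburnRep lt c ℓ s) {j : ℕ} (hj : j ≤ ℓ) : ∃ x, (c x).1 = j := by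
  obtain ⟨p, hp, rfl⟩ := h.fishburn.exists_fst j hj
  obtain ⟨x, -, rfl⟩ := Multiset.mem_map.1 hp
  exact ⟨x, rfl⟩

lemma exists_snd (h : IsFishburnRep lt c ℓ s) {j : ℕ} (hj : j ≤ ℓ) : ∃ x, (c x).2 = j := by
  obtain ⟨p, hp, rfl⟩ := h.fishburn.exists_snd j hj
  obtain ⟨x, -, rfl⟩ := Multiset.mem_map.1 hp
  exact ⟨x, rfl⟩

lemma exists_bot (h : IsFishburnRep lt c ℓ s) : ∃ x, c x = (s, ℓ) := by
  obtain ⟨x, -, hx⟩ := Multiset.mem_map.1 h.fishburn.mem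
  exact ⟨x, hx⟩

lemma downSet_eq (h : IsFishburnRep lt c ℓ s) (x : Q) :
    downSet lt x = {y | (c y).2 < (c x).1} := by
  ext y
  exact h.lt_iff y x

/-- Strictness comes from column j being nonempty. Thus the distinct strict down-sets are indexed by
0, …, ℓ. -/
lemma under_ssubset_iff (h : IsFishburnRep lt c ℓ s) {j k : ℕ} (hj : j ≤ ℓ) :
    {y | (c y).2 < j} ⊂ {y | (c y).2 < k} ↔ j < k := by
  constructor
  · intro hs
    by_contra hjk
    exact hs.2 fun y (hy : _ < k) => show _ < j by omega
  · intro hjk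
    refine ⟨fun y (hy : _ < j) => show _ < k by omega, fun hs => ?_⟩
    obtain ⟨x, hx⟩ := h.exists_snd hj
    have : (c x).2 < j := hs (show _ < k by omega)
    omega

lemma injOn_under (h : IsFishburnRep lt c ℓ s) :
    Set.InjOn (fun j => {y | (c y).2 < j}) (Set.Iic ℓ) := by
  intro j hj k hk hjk
  rcases lt_trichotomy j k with hlt | rfl | hlt
  · exact absurd hjk ((h.under_ssubset_iff hj).2 hlt).ne
  · rfl
  · exact absurd hjk ((h.under_ssubset_iff hk).2 hlt).ne'

lemma range_downSet (h : IsFishburnRep lt c ℓ s) :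
    Set.range (downSet lt) = (fun j => {y | (c y).2 < j}) '' Set.Iic ℓ := by
  ext D
  constructor
  · rintro ⟨x, rfl⟩
    exact ⟨(c x).1, h.fst_le x, (h.downSet_eq x).symm⟩
  · rintro ⟨j, hj, rfl⟩
    obtain ⟨x, rfl⟩ := h.exists_fst hj
    exact ⟨x, h.downSet_eq x⟩

lemma level_eq (h : IsFishburnRep lt c ℓ s) (x : Q) : level lt x = (c x).1 := by
  have key : {D ∈ Set.range (downSet lt) | D ⊂ downSet lt x} =
      (fun j => {y | (c y).2 < j}) '' Set.Iio (c x).1 := by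
    ext D
    rw [h.range_downSet, h.downSet_eq]
    constructor
    · rintro ⟨⟨j, hj, rfl⟩, hD⟩
      exact ⟨j, (h.under_ssubset_iff hj).1 hD, rfl⟩
    · rintro ⟨j, hj, rfl⟩
      have hjl : j ≤ ℓ := (Set.mem_Iio.1 hj).le.trans (h.fst_le x)
      exact ⟨⟨j, hjl, rfl⟩, (h.under_ssubset_iff hjl).2 hj⟩
  have hinj := h.injOn_under.mono fun j (hj : j ∈ Set.Iio (c x).1) =>
    (Set.mem_Iio.1 hj).le.trans (h.fst_le x)
  rw [level, key, hinj.ncard_image, ← Finset.coe_Iio, Set.ncard_coe_finset, Nat.card_Iio]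

lemma topLevel_eq (h : IsFishburnRep lt c ℓ s) : topLevel lt = ℓ := by
  rw [topLevel, h.range_downSet, h.injOn_under.ncard_image, ← Finset.coe_Iic,
    Set.ncard_coe_finset, Nat.card_Iic, Nat.add_sub_cancel]

lemma isMaxElt_iff (h : IsFishburnRep lt c ℓ s) (x : Q) : IsMaxElt lt x ↔ (c x).2 = ℓ := by
  constructor
  · intro hx
    obtain ⟨y, hy⟩ := h.exists_fst le_rfl
    have := hx y
    rw [h.lt_iff, hy] at this
    exact le_antisymm (h.snd_le x) (not_lt.1 this)
  · intro hx y hxy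
    rw [h.lt_iff, hx] at hxy
    exact absurd (h.fst_le y) (not_le.2 hxy)

lemma minMaxLevel_eq (h : IsFishburnRep lt c ℓ s) : minMaxLevel lt = s := by
  apply le_antisymm
  · obtain ⟨x, hx⟩ := h.exists_bot
    exact Nat.sInf_le ⟨x, by simp [h.isMaxElt_iff, hx], by simp [h.level_eq, hx]⟩
  · refine le_csInf ?_ ?_
    · obtain ⟨x, hx⟩ := h.exists_bot
      exact ⟨_, x, by simp [h.isMaxElt_iff, hx], rfl⟩
    · rintro _ ⟨x, hx, rfl⟩
      rw [h.level_eq]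
      exact h.fishburn.le_fst _ (by simp) ((h.isMaxElt_iff x).1 hx)

lemma levelDownSet_iff (h : IsFishburnRep lt c ℓ s) {i : ℕ} (hi : i ≤ ℓ) (x : Q) :
    levelDownSet lt i x ↔ (c x).2 < i := by
  simp only [levelDownSet, h.level_eq, h.lt_iff]
  constructor
  · rintro ⟨y, rfl, hy⟩
    exact hy
  · intro hx
    obtain ⟨y, hy⟩ := h.exists_fst hi
    exact ⟨y, hy, hy ▸ hx⟩

/-- The first coordinate is the level. Since every j ≤ ℓ is a level, the order decides whether the
second coordinate is less than j, which fixes it. -/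
lemma rep_unique (h : IsFishburnRep lt c ℓ s) {c' : Q → ℕ × ℕ} {ℓ' s' : ℕ}
    (h' : IsFishburnRep lt c' ℓ' s') : c = c' := by
  obtain rfl : ℓ = ℓ' := by rw [← h.topLevel_eq, h'.topLevel_eq]
  have h1 : ∀ x, (c x).1 = (c' x).1 := fun x => by rw [← h.level_eq, h'.level_eq]
  have h2 : ∀ x, ∀ j ≤ ℓ, (c x).2 < j ↔ (c' x).2 < j := by
    intro x j hj
    obtain ⟨y, rfl⟩ := h.exists_fst hj
    rw [← h.lt_iff, h1, ← h'.lt_iff]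
  funext x
  refine Prod.ext (h1 x) ?_
  have := h2 x (c x).2 (h.snd_le x)
  have := h2 x (c' x).2 (h'.snd_le x)
  omega

lemma comp_equiv (h : IsFishburnRep lt c ℓ s) {Q' : Type*} [Fintype Q'] (e : Q' ≃ Q) :
    IsFishburnRep (fun x y => lt (e x) (e y)) (c ∘ e) ℓ s :=
  ⟨by rw [Multiset.map_univ_val_comp_equiv]; exact h.fishburn, fun x y => h.lt_iff _ _⟩

/-- A nonempty column separates different first coordinates, and a nonempty row separates different
second ones. -/
lemma eq_iff (h : IsFishburnRep lt c ℓ s) (x y : Q) :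
    c x = c y ↔ ∀ z, (lt x z ↔ lt y z) ∧ (lt z x ↔ lt z y) := by
  constructor
  · intro hxy z
    simp only [h.lt_iff, hxy, and_self]
  · intro hxy
    simp only [h.lt_iff] at hxy
    refine Prod.ext ?_ ?_
    · by_contra hne
      rcases Nat.lt_or_gt_of_ne hne with hlt | hlt
      · obtain ⟨z, hz⟩ := h.exists_snd (h.fst_le x)
        have := (hxy z).2
        omega
      · obtain ⟨z, hz⟩ := h.exists_snd (h.fst_le y)
        have := (hxy z).2
        omega
    · by_contra hne
      rcases Nat.lt_or_gt_of_ne hne with hlt | hlt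
      · obtain ⟨z, hz⟩ := h.exists_fst (h.snd_le y)
        have := (hxy z).1
        omega
      · obtain ⟨z, hz⟩ := h.exists_fst (h.snd_le x)
        have := (hxy z).1
        omega

end IsFishburnRep

/-! ### Interval representations of (2+2)-free posets. -/

/-- A finite nonempty irreflexive relation whose strict down-sets form a chain has a
representation. -/
lemma exists_isFishburnRep {Q : Type*} [Fintype Q] [Nonempty Q] {lt : Q → Q → Prop}
    (hirr : ∀ x, ¬ lt x x)
    (hchain : ∀ x y, downSet lt x ⊆ downSet lt y ∨ downSet lt y ⊆ downSet lt x) :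
    ∃ c ℓ s, IsFishburnRep lt c ℓ s := by
  classical
  set R := Set.range (downSet lt) with hR
  have hfin : ∀ T : Set (Set Q), T.Finite := fun T => Set.toFinite T
  -- The down-sets avoiding x form an initial segment of the chain, nonempty because x avoids its
  -- own; subtracting 1 turns their number into the index of the last one.
  set b : Q → ℕ := fun x => Set.ncard {D ∈ R | x ∉ D} - 1 with hb
  have hmem : ∀ x, downSet lt x ∈ R := fun x => ⟨x, rfl⟩
  have hlevel : ∀ y, level lt y = Set.ncard {D ∈ R | D ⊂ downSet lt y} := fun _ => rfl
  have htop : topLevel lt = R.ncard - 1 := rfl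
  have hpos : ∀ x, 0 < Set.ncard {D ∈ R | x ∉ D} := fun x =>
    (Set.ncard_pos (hfin _)).2 ⟨downSet lt x, hmem x, hirr x⟩
  have hRpos : 0 < Set.ncard R :=
    (Set.ncard_pos (hfin _)).2 ⟨_, hmem (Classical.arbitrary Q)⟩
  have hlt : ∀ x y, lt x y ↔ b x < level lt y := by
    intro x y
    constructor
    · intro hxy
      have hsub : {D ∈ R | x ∉ D} ⊆ {D ∈ R | D ⊂ downSet lt y} := by
        rintro _ ⟨⟨z, rfl⟩, hz⟩
        refine ⟨hmem z, ?_⟩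
        rcases hchain z y with h | h
        · exact ⟨h, fun h' => hz (h' hxy)⟩
        · exact absurd (h hxy) hz
      have := Set.ncard_le_ncard hsub (hfin _)
      have := hpos x
      simp only [hb, hlevel]
      omega
    · intro hxy
      by_contra hn
      have hsub : insert (downSet lt y) {D ∈ R | D ⊂ downSet lt y} ⊆ {D ∈ R | x ∉ D} := by
        rintro D (rfl | ⟨hD, hDy⟩)
        · exact ⟨hmem y, hn⟩
        · exact ⟨hD, fun hx => hn (hDy.1 hx)⟩
      have h1 := Set.ncard_le_ncard hsub (hfin _)
      rw [Set.ncard_insert_of_notMem (fun h => h.2.2 subset_rfl) (hfin _)] at h1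
      simp only [hb, hlevel] at hxy
      omega
  have hsnd : ∀ x, b x ≤ topLevel lt := fun x =>
    Nat.sub_le_sub_right (Set.ncard_le_ncard (fun D hD => hD.1) (hfin _)) 1
  have hle : ∀ x, level lt x ≤ b x := fun x => not_lt.1 fun h => hirr x ((hlt x x).2 h)
  have hmono : ∀ x y, downSet lt x ⊂ downSet lt y → level lt x < level lt y := by
    intro x y hxy
    refine Set.ncard_lt_ncard ⟨fun D hD => ⟨hD.1, hD.2.trans hxy⟩, fun h => ?_⟩ (hfin _)
    exact (h (show downSet lt x ∈ {D ∈ R | D ⊂ downSet lt y} from ⟨hmem x, hxy⟩)).2.2 subset_rfl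
  -- Distinct down-sets have distinct levels between 0 and the top, so by counting every level
  -- occurs.
  have hlev : Set.range (level lt) = Set.Iic (topLevel lt) := by
    have himg : Set.range (level lt) =
        (fun E => Set.ncard {D ∈ R | D ⊂ E}) '' R := by
      rw [hR, ← Set.range_comp]
      rfl
    have hinj : Set.InjOn (fun E => Set.ncard {D ∈ R | D ⊂ E}) R := by
      rintro _ ⟨x, rfl⟩ _ ⟨y, rfl⟩ hxy
      by_contra hne
      rcases hchain x y with h | h
      · exact (hmono x y (h.ssubset_of_ne hne)).ne hxy
      · exact (hmono y x (h.ssubset_of_ne (Ne.symm hne))).ne' hxy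
    refine Set.eq_of_subset_of_ncard_le ?_ ?_ (Set.finite_Iic _)
    · rintro _ ⟨x, rfl⟩
      exact (hle x).trans (hsnd x)
    · rw [himg, hinj.ncard_image, ← Finset.coe_Iic, Set.ncard_coe_finset,
        Nat.card_Iic, htop]
      omega
  have hex : ∀ j ≤ topLevel lt, ∃ x, level lt x = j := fun j hj => hlev.ge hj
  obtain ⟨s, hs⟩ : ∃ s, IsFishburn (Finset.univ.val.map fun x => (level lt x, b x))
      (topLevel lt) s := by
    refine IsFishburn.exists_of ?_ ?_ ?_ ?_
    · simpa using hle
    · simpa using hsnd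
    · simpa using hex
    · intro j hj
      suffices ∃ x, b x = j by simpa using this
      obtain ⟨y, hy⟩ := hex j hj
      rcases hj.eq_or_lt with rfl | hj
      · exact ⟨y, le_antisymm (hsnd y) (hy ▸ hle y)⟩
      · obtain ⟨z, hz⟩ := hex (j + 1) hj
        -- An element in the down-set of level j + 1 but not in that of level j has second
        -- coordinate j.
        have hnsub : ¬ downSet lt z ⊆ downSet lt y := by
          intro hsub
          rcases hsub.eq_or_ssubset with h | h
          · have : level lt z = level lt y := by rw [level, level, h]
            omega
          · have := hmono z y h
            omega
        obtain ⟨x, hxz, hxy⟩ := Set.not_subset.1 hnsub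
        have h1 := (hlt x z).1 hxz
        have h2 := mt (hlt x y).2 hxy
        exact ⟨x, by omega⟩
  exact ⟨fun x => (level lt x, b x), topLevel lt, s, hs, hlt⟩

/-- A finite nonempty `(2+2)`-free poset has a representation. -/
lemma exists_isFishburnRep_of_mem {X : Type*} [Fintype X] [Nonempty X] {r : X → X → Prop}
    (hr : r ∈ TwoPlusTwoFreePosets X) :
    ∃ c ℓ s, IsFishburnRep (fun x y => r x y ∧ x ≠ y) c ℓ s := by
  obtain ⟨hpo, hfree⟩ := hr
  have hrefl : ∀ x, r x x := fun x => hpo.refl x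
  have htrans : ∀ {x y z}, r x y → r y z → r x z := fun h h' => hpo.trans _ _ _ h h'
  have hanti : ∀ {x y}, r x y → r y x → x = y := fun h h' => hpo.antisymm _ _ h h'
  refine exists_isFishburnRep (fun x h => h.2 rfl) fun x y => ?_
  by_contra hcon
  simp only [not_or, Set.not_subset, downSet, Set.mem_ofPred_eq] at hcon
  -- Incomparable down-sets give the chains u < x and v < y of a forbidden 2+2. Non-membership in a
  -- strict down-set still allows u = y or v = x; these cases fall to transitivity.
  obtain ⟨⟨u, ⟨hux, hux'⟩, huy⟩, ⟨v, ⟨hvy, hvy'⟩, hvx⟩⟩ := hcon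
  have huy1 : ¬ r u y := fun h => huy ⟨h, by rintro rfl; exact hvx ⟨htrans hvy hux, by
    rintro rfl; exact hux' (hanti hux hvy)⟩⟩
  have hvx1 : ¬ r v x := fun h => hvx ⟨h, by rintro rfl; exact huy1 (htrans hux hvy)⟩
  have hxu : ¬ r x u := fun h => hux' (hanti hux h)
  have hyv : ¬ r y v := fun h => hvy' (hanti hvy h)
  have huv : ¬ r u v := fun h => huy1 (htrans h hvy)
  have hvu : ¬ r v u := fun h => hvx1 (htrans h hux)
  have hxy : ¬ r x y := fun h => huy1 (htrans hux h)
  have hyx : ¬ r y x := fun h => hvx1 (htrans hvy h)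
  have hxv : ¬ r x v := fun h => huv (htrans hux h)
  have hyu : ¬ r y u := fun h => hvu (htrans hvy h)
  let g : Fin 2 ⊕ Fin 2 → X := Sum.elim ![u, x] ![v, y]
  have hg : ∀ p q, r (g p) (g q) ↔ p ≤ q := by
    rintro (p | p) (q | q) <;> fin_cases p <;> fin_cases q <;>
      simp [g, *]
  refine hfree.false ⟨⟨g, fun p q hpq => ?_⟩, fun {p q} => hg p q⟩
  exact le_antisymm ((hg p q).1 (hpq ▸ hrefl _)) ((hg q p).1 (hpq ▸ hrefl _))

/-- Pairs of natural numbers with `a ≤ b` define a `(2+2)`-free partial order. -/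
lemma mem_twoPlusTwoFreePosets_of_pairs {X : Type*} {r : X → X → Prop} {c : X → ℕ × ℕ}
    (hc : ∀ x, (c x).1 ≤ (c x).2) (hr : ∀ x y, r x y ↔ x = y ∨ (c x).2 < (c y).1) :
    r ∈ TwoPlusTwoFreePosets X := by
  refine ⟨?_, ⟨fun g => ?_⟩⟩
  · refine { refl := fun x => (hr x x).2 (.inl rfl), trans := ?_, antisymm := ?_ }
    · intro x y z hxy hyz
      rw [hr] at *
      rcases hxy with rfl | hxy
      · exact hyz
      · rcases hyz with rfl | hyz
        · exact .inr hxy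
        · have := hc y
          exact .inr (by omega)
    · intro x y hxy hyx
      rw [hr] at *
      rcases hxy with rfl | hxy
      · rfl
      · rcases hyx with rfl | hyx
        · rfl
        · have := hc x
          have := hc y
          omega
  · have key : ∀ p q, p ≤ q ∧ p ≠ q → (c (g p)).2 < (c (g q)).1 := by
      rintro p q ⟨h, hne⟩
      exact ((hr _ _).1 (g.map_rel_iff.2 h)).resolve_left fun h' => hne (g.injective h')
    have key' : ∀ p q, ¬ p ≤ q → ¬ (c (g p)).2 < (c (g q)).1 := fun p q h h' =>
      h (g.map_rel_iff.1 ((hr _ _).2 (.inr h')))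
    -- Writing u < x and v < y for the two chains, the four facts form an impossible cycle b(u) <
    -- a(x) ≤ b(v) < a(y) ≤ b(u).
    have h1 := key (.inl 0) (.inl 1) (by simp)
    have h2 := key (.inr 0) (.inr 1) (by simp)
    have h3 := key' (.inl 0) (.inr 1) (by simp)
    have h4 := key' (.inr 0) (.inl 1) (by simp)
    omega

/-! ### One step of the construction -/

section adjoin

variable {k : ℕ} (lt : Fin k → Fin k → Prop) (D : Fin k → Prop)

lemma adjoin_castSucc_castSucc (x y : Fin k) : adjoin lt D x.castSucc y.castSucc ↔ lt x y := by
  simp [adjoin]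

lemma adjoin_castSucc_last (x : Fin k) : adjoin lt D x.castSucc (Fin.last k) ↔ D x := by
  simp [adjoin]

lemma adjoin_last (v : Fin (k + 1)) : ¬ adjoin lt D (Fin.last k) v := by
  simp [adjoin]

end adjoin

lemma Multiset.map_univ_val_snoc {k : ℕ} {Z : Type*} (c : Fin k → Z) (z : Z) :
    (Finset.univ : Finset (Fin (k + 1))).val.map (Fin.snoc (α := fun _ => Z) c z) =
      z ::ₘ (Finset.univ : Finset (Fin k)).val.map c := by
  rw [Fin.univ_castSuccEmb, Finset.cons_val, Multiset.map_cons, Fin.snoc_last, Finset.map_val,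
    Multiset.map_map]
  congr 1
  exact Multiset.map_congr rfl fun x _ => by simp

lemma IsFishburnRep.addElement {k : ℕ} {lt : Fin k → Fin k → Prop} {c : Fin k → ℕ × ℕ} {ℓ s i : ℕ}
    (h : IsFishburnRep lt c ℓ s) (hi : i ≤ ℓ + 1) :
    IsFishburnRep (addElement lt i)
      (Fin.snoc (α := fun _ => ℕ × ℕ) (pairShift ℓ s i ∘ c) (i, nextTop ℓ s i))
      (nextTop ℓ s i) i := by
  have hs := h.fishburn.bot_le_top
  constructor
  · rw [Multiset.map_univ_val_snoc, ← Multiset.map_map]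
    exact h.fishburn.addPair hi
  · have hnext : i ≤ nextTop ℓ s i := by unfold nextTop; split_ifs <;> omega
    intro u v
    unfold _root_.addElement
    rw [h.minMaxLevel_eq, h.topLevel_eq]
    -- The new element is maximal: no first coordinate exceeds the new top level.
    have hlast : ∀ v, ¬ ((nextTop ℓ s i) < (Fin.snoc (α := fun _ => ℕ × ℕ)
        (pairShift ℓ s i ∘ c) (i, nextTop ℓ s i) v).1) := by
      intro v
      refine Fin.lastCases ?_ (fun x => ?_) v
      · simpa using hnext
      · have := h.fst_le x
        simp only [Fin.snoc_castSucc, Function.comp_apply, pairShift, nextTop]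
        split_ifs <;> omega
    by_cases h1 : i ≤ s
    · rw [if_pos h1, add1]
      refine Fin.lastCases ?_ (fun x => ?_) u
      · simp only [adjoin_last, Fin.snoc_last, hlast]
      · refine Fin.lastCases ?_ (fun y => ?_) v
        · rw [adjoin_castSucc_last, h.levelDownSet_iff (by omega)]
          simp [pairShift_eq_self (Or.inl h1)]
        · rw [adjoin_castSucc_castSucc, h.lt_iff]
          simp [pairShift_eq_self (Or.inl h1)]
    · rw [if_neg h1]
      by_cases h2 : i ≤ ℓ
      · have hc : ¬ (i ≤ s ∨ ℓ < i) := by omega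
        rw [if_pos h2, add3]
        refine Fin.lastCases ?_ (fun x => ?_) u
        · simp only [adjoin_last, Fin.snoc_last, hlast]
        · have hx := h.fst_le_snd x
          have hx' := h.snd_le x
          refine Fin.lastCases ?_ (fun y => ?_) v
          · rw [adjoin_castSucc_last, h.levelDownSet_iff (by omega)]
            simp only [Fin.snoc_castSucc, Fin.snoc_last, Function.comp_apply, pairShift, if_neg hc]
            split_ifs <;> omega
          · rw [adjoin_castSucc_castSucc, h.lt_iff, h.isMaxElt_iff, h.level_eq, h.level_eq]
            have hy := h.fst_le y
            simp only [Fin.snoc_castSucc, Function.comp_apply, pairShift, if_neg hc]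
            split_ifs <;> omega
      · rw [if_neg h2, add2]
        refine Fin.lastCases ?_ (fun x => ?_) u
        · simp only [adjoin_last, Fin.snoc_last, hlast]
        · refine Fin.lastCases ?_ (fun y => ?_) v
          · rw [adjoin_castSucc_last]
            have := h.snd_le x
            simp [pairShift_eq_self (Or.inr (not_le.1 h2))]
            omega
          · rw [adjoin_castSucc_castSucc, h.lt_iff]
            simp [pairShift_eq_self (Or.inr (not_le.1 h2))]

/-! ### The pairs of an ascent sequence -/

lemma asc_eq_card {n : ℕ} (α : Fin n → ℕ) (i : ℕ) :
    asc α i = (Finset.univ.filter fun p : Fin n × Fin n =>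
      (p.1 : ℕ) + 1 = (p.2 : ℕ) ∧ (p.2 : ℕ) < i ∧ α p.1 < α p.2).card := by
  rw [asc, Fintype.card_subtype]

lemma asc_one {n : ℕ} (α : Fin n → ℕ) : asc α 1 = 0 := by
  rw [asc_eq_card, Finset.card_eq_zero, Finset.filter_eq_empty_iff]
  rintro p - h
  omega

lemma asc_castSucc {n : ℕ} (α : Fin (n + 1) → ℕ) {i : ℕ} (hi : i ≤ n) :
    asc (fun j : Fin n => α j.castSucc) i = asc α i := by
  rw [asc_eq_card, asc_eq_card]
  refine Finset.card_bij (fun p _ => (p.1.castSucc, p.2.castSucc)) ?_ ?_ ?_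
  · intro p hp
    simpa using hp
  · rintro p - q - h
    simpa [Prod.ext_iff] using h
  · rintro ⟨u, v⟩ h
    simp only [Finset.mem_filter, Finset.mem_univ, true_and] at h
    exact ⟨(⟨u, by omega⟩, ⟨v, by omega⟩), by simpa using h, rfl⟩

/-- The ascent number obeys the recursion of the top level: it grows exactly when the new entry
exceeds the previous one, which plays the part of s. -/
lemma asc_succ {n : ℕ} (α : Fin (n + 2) → ℕ) :
    asc α (n + 2) = nextTop (asc (fun j : Fin (n + 1) => α j.castSucc) (n + 1))
      (α (Fin.last n).castSucc) (α (Fin.last (n + 1))) := by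
  rw [asc_castSucc α le_rfl, nextTop, asc_eq_card, asc_eq_card]
  split_ifs with h
  · congr 1
    ext ⟨u, v⟩
    simp only [Finset.mem_filter, Finset.mem_univ, true_and]
    refine ⟨fun ⟨h1, h2, h3⟩ => ⟨h1, ?_, h3⟩, fun ⟨h1, h2, h3⟩ => ⟨h1, by omega, h3⟩⟩
    by_contra hv
    obtain rfl : v = Fin.last (n + 1) := Fin.ext (by simp; omega)
    obtain rfl : u = (Fin.last n).castSucc := Fin.ext (by simp at *; omega)
    exact absurd h3 (not_lt.2 h)
  · rw [← Finset.card_insert_of_notMem (a := ((Fin.last n).castSucc, Fin.last (n + 1))) (by simp)]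
    congr 1
    ext ⟨u, v⟩
    simp only [Finset.mem_filter, Finset.mem_univ, true_and, Finset.mem_insert, Prod.ext_iff]
    constructor
    · rintro ⟨h1, h2, h3⟩
      by_cases hv : (v : ℕ) < n + 1
      · exact .inr ⟨h1, hv, h3⟩
      · exact .inl ⟨Fin.ext (by simp; omega), Fin.ext (by simp; omega)⟩
    · rintro (⟨rfl, rfl⟩ | ⟨h1, h2, h3⟩)
      · exact ⟨by simp, by simp, not_le.1 h⟩
      · exact ⟨h1, by omega, h3⟩

lemma isAscentSeq_one_iff {α : Fin 1 → ℕ} : IsAscentSeq α ↔ α 0 = 0 := by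
  simp [IsAscentSeq]

lemma isAscentSeq_succ_iff {n : ℕ} {α : Fin (n + 2) → ℕ} :
    IsAscentSeq α ↔ IsAscentSeq (fun j : Fin (n + 1) => α j.castSucc) ∧
      α (Fin.last (n + 1)) ≤ 1 + asc (fun j : Fin (n + 1) => α j.castSucc) (n + 1) := by
  have hasc : ∀ j : Fin (n + 1), asc (fun j : Fin (n + 1) => α j.castSucc) j = asc α j :=
    fun j => asc_castSucc α (by omega)
  unfold IsAscentSeq
  rw [Fin.forall_fin_succ']
  simp [hasc, asc_castSucc α le_rfl]

/-- The pairs of the elements of the poset constructed from `α`, found by recursion. -/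
def ascentRep : (k : ℕ) → (Fin (k + 1) → ℕ) → Fin (k + 1) → ℕ × ℕ
  | 0, _ => fun _ => (0, 0)
  | k + 1, α => Fin.snoc (α := fun _ => ℕ × ℕ)
      (pairShift (asc (fun j : Fin (k + 1) => α j.castSucc) (k + 1)) (α (Fin.last k).castSucc)
        (α (Fin.last (k + 1))) ∘ ascentRep k fun j => α j.castSucc)
      (α (Fin.last (k + 1)), nextTop (asc (fun j : Fin (k + 1) => α j.castSucc) (k + 1))
        (α (Fin.last k).castSucc) (α (Fin.last (k + 1))))

lemma ascentRep_last {k : ℕ} {α : Fin (k + 1) → ℕ} (hα : IsAscentSeq α) :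
    ascentRep k α (Fin.last k) = (α (Fin.last k), asc α (k + 1)) := by
  cases k with
  | zero => simp [ascentRep, asc_one, isAscentSeq_one_iff.1 hα]
  | succ k => rw [ascentRep, Fin.snoc_last, asc_succ]

lemma map_ascentRep_succ {k : ℕ} (α : Fin (k + 2) → ℕ) :
    Finset.univ.val.map (ascentRep (k + 1) α) =
      addPair (asc (fun j : Fin (k + 1) => α j.castSucc) (k + 1)) (α (Fin.last k).castSucc)
        (α (Fin.last (k + 1))) (Finset.univ.val.map (ascentRep k fun j => α j.castSucc)) := by
  rw [ascentRep, Multiset.map_univ_val_snoc, addPair, Multiset.map_map]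

lemma not_addElement_last {k : ℕ} (lt : Fin k → Fin k → Prop) (i : ℕ) (v : Fin (k + 1)) :
    ¬ addElement lt i (Fin.last k) v := by
  obtain ⟨lt', D, h⟩ : ∃ lt' D, addElement lt i = adjoin lt' D := by
    unfold addElement add1 add2 add3
    split_ifs <;> exact ⟨_, _, rfl⟩
  rw [h]
  exact adjoin_last _ _ _

lemma isFishburnRep_ascentRep {k : ℕ} {α : Fin (k + 1) → ℕ} (hα : IsAscentSeq α) :
    IsFishburnRep (ascentPoset (k + 1) α) (ascentRep k α) (asc α (k + 1)) (α (Fin.last k)) := by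
  induction k with
  | zero =>
    have h0 : α (Fin.last 0) = 0 := isAscentSeq_one_iff.1 hα
    constructor
    · rw [asc_one, h0]
      constructor <;> simp [ascentRep]
    · intro x y
      obtain rfl : x = Fin.last 0 := Subsingleton.elim (α := Fin 1) _ _
      simp only [ascentRep, lt_self_iff_false, iff_false, ascentPoset]
      exact not_addElement_last _ _ _
  | succ k ih =>
    obtain ⟨h1, h2⟩ := isAscentSeq_succ_iff.1 hα
    rw [asc_succ]
    exact (ih h1).addElement (by omega)

/-- Shifting is injective, so equalities among old pairs persist. The new pair equals an old one
only if the entry repeats and the old pair is that of the preceding element. -/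
lemma ascentRep_eq_iff {k : ℕ} {α : Fin (k + 1) → ℕ} (hα : IsAscentSeq α) {i j : Fin (k + 1)}
    (hij : i ≤ j) :
    ascentRep k α i = ascentRep k α j ↔ ∀ m, i ≤ m → m ≤ j → α m = α j := by
  induction k with
  | zero =>
    simp only [ascentRep, true_iff]
    intro m _ _
    rw [Subsingleton.elim (α := Fin 1) m j]
  | succ k ih =>
    obtain ⟨h1, h2⟩ := isAscentSeq_succ_iff.1 hα
    have hrep := isFishburnRep_ascentRep h1
    revert hij
    refine Fin.lastCases ?_ (fun y => ?_) j
    · refine Fin.lastCases ?_ (fun x => ?_) i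
      · intro _
        simp only [true_iff]
        intro m hm _
        rw [le_antisymm (Fin.le_last m) hm]
      · intro _
        have hih := ih h1 (Fin.le_last x)
        have hlast := ascentRep_last h1
        rw [ascentRep, Fin.snoc_castSucc, Fin.snoc_last, Function.comp_apply]
        constructor
        · intro h
          have hle : α (Fin.last (k + 1)) ≤ α (Fin.last k).castSucc := by
            by_contra hgt
            exact pairShift_fst_ne (not_le.1 hgt) (hrep.fst_le x) (congrArg Prod.fst h)
          rw [pairShift_eq_self (.inl hle), nextTop, if_pos hle, id] at h
          -- The top level is unchanged, so x lies in the top column, where first coordinates are at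
          -- least the previous entry.
          have hge := hrep.fishburn.le_fst _ (Multiset.mem_map_of_mem _ (Finset.mem_univ x))
            (by rw [h])
          rw [h] at hge
          have heq : α (Fin.last (k + 1)) = α (Fin.last k).castSucc := le_antisymm hle hge
          rw [heq] at h
          have hall := hih.1 (h.trans hlast.symm)
          intro m
          refine Fin.lastCases (fun _ _ => rfl) (fun m => ?_) m
          intro hm _
          rw [heq]
          exact hall m hm (Fin.le_last m)
        · intro h
          have heq : α (Fin.last (k + 1)) = α (Fin.last k).castSucc :=
            (h _ (Fin.le_last x) (Fin.le_last _)).symm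
          rw [pairShift_eq_self (.inl heq.le), nextTop, if_pos heq.le, id, heq, ← hlast, hih]
          intro m hm _
          rw [h m.castSucc hm (Fin.le_last _), heq]
    · refine Fin.lastCases ?_ (fun x => ?_) i
      · intro h
        exact absurd h (not_le.2 (Fin.castSucc_lt_last y))
      · intro hxy
        rw [ascentRep, Fin.snoc_castSucc, Fin.snoc_castSucc, Function.comp_apply,
          Function.comp_apply]
        trans ascentRep k (fun j => α j.castSucc) x = ascentRep k (fun j => α j.castSucc) y
        · refine ⟨fun h => ?_, fun h => by rw [h]⟩
          exact pairShift_injOn (hrep.fst_le_snd x) (hrep.snd_le x) (hrep.fst_le_snd y)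
            (hrep.snd_le y) h
        · rw [ih h1 hxy]
          constructor
          · intro h m
            refine Fin.lastCases (fun _ hm => ?_) (fun m hm hm' => h m hm hm') m
            exact absurd hm (not_le.2 (Fin.castSucc_lt_last y))
          · exact fun h m hm hm' => h m.castSucc hm hm'

lemma eq_of_map_ascentRep_eq {k : ℕ} {α β : Fin (k + 1) → ℕ} (hα : IsAscentSeq α)
    (hβ : IsAscentSeq β)
    (h : Finset.univ.val.map (ascentRep k α) = Finset.univ.val.map (ascentRep k β)) : α = β := by
  induction k with
  | zero =>
    funext i
    rw [Subsingleton.elim (α := Fin 1) i 0, isAscentSeq_one_iff.1 hα, isAscentSeq_one_iff.1 hβ]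
  | succ k ih =>
    obtain ⟨hα1, hα2⟩ := isAscentSeq_succ_iff.1 hα
    obtain ⟨hβ1, hβ2⟩ := isAscentSeq_succ_iff.1 hβ
    rw [map_ascentRep_succ, map_ascentRep_succ] at h
    obtain ⟨hl, hS⟩ := (isFishburnRep_ascentRep hα1).fishburn.addPair_inj
      (isFishburnRep_ascentRep hβ1).fishburn (by omega) (by omega) h
    have := ih hα1 hβ1 hS
    funext i
    exact Fin.lastCases hl (fun i => congrFun this i) i

/-- Elements are removed by `IsFishburn.exists_addPair`; its bound on s is the ascent condition for
the last entry. -/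
lemma exists_map_ascentRep_eq {k : ℕ} {S : Multiset (ℕ × ℕ)} {ℓ s : ℕ} (hS : IsFishburn S ℓ s)
    (hcard : S.card = k + 1) :
    ∃ α : Fin (k + 1) → ℕ, IsAscentSeq α ∧ Finset.univ.val.map (ascentRep k α) = S := by
  induction k generalizing S ℓ s with
  | zero =>
    refine ⟨fun _ => 0, isAscentSeq_one_iff.2 rfl, ?_⟩
    obtain ⟨p, rfl⟩ := Multiset.card_eq_one.1 hcard
    obtain ⟨q, hq, h1⟩ := hS.exists_fst 0 (Nat.zero_le _)
    obtain ⟨q', hq', h2⟩ := hS.exists_snd 0 (Nat.zero_le _)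
    rw [Multiset.mem_singleton] at hq hq'
    subst hq hq'
    obtain rfl : q' = (0, 0) := Prod.ext h1 h2
    rfl
  | succ k ih =>
    obtain ⟨S', ℓ', s', hS', hs, rfl⟩ := hS.exists_addPair (by omega)
    obtain ⟨α, hα, rfl⟩ := ih hS' (by simpa [addPair] using hcard)
    have hrep := (isFishburnRep_ascentRep hα).fishburn
    obtain rfl := hrep.top_unique hS'
    obtain rfl := hrep.bot_unique hS'
    refine ⟨Fin.snoc (α := fun _ => ℕ) α s, ?_, ?_⟩
    · rw [isAscentSeq_succ_iff]
      simpa [add_comm 1] using ⟨hα, hs⟩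
    · rw [map_ascentRep_succ]
      simp

/-! ### Runs -/

lemma List.IsChain.rel_of_infix {A : Type*} {R : A → A → Prop} {L : List A} (h : L.IsChain R)
    {a b : A} (hab : [a, b] <:+: L) : R a b := by
  simpa using h.infix hab

section runs

variable {n : ℕ} {α : Fin n → ℕ}

lemma flatten_runs (α : Fin n → ℕ) : (runs α).flatten = List.finRange n :=
  List.flatten_splitBy _ _

lemma ne_nil_of_mem_runs {l : List (Fin n)} (hl : l ∈ runs α) : l ≠ [] :=
  List.ne_nil_of_mem_splitBy hl

lemma exists_mem_runs (α : Fin n → ℕ) (i : Fin n) : ∃ l ∈ runs α, i ∈ l := by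
  rw [← List.mem_flatten, flatten_runs]
  exact List.mem_finRange i

lemma eq_of_mem_run {l : List (Fin n)} (hl : l ∈ runs α) {i j : Fin n} (hi : i ∈ l) (hj : j ∈ l) :
    α i = α j := by
  have h := List.isChain_of_mem_splitBy hl
  simp only [beq_iff_eq] at h
  have : IsTrans (Fin n) fun x y => α x = α y := ⟨fun _ _ _ => Eq.trans⟩
  have : Std.Symm fun x y : Fin n => α x = α y := ⟨fun _ _ => Eq.symm⟩
  exact List.Pairwise.forall_of_forall (R := fun x y => α x = α y) (fun _ _ => rfl)
    (List.isChain_iff_pairwise.1 h) hi hj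

/-- Runs are intervals because they concatenate to the increasing list of positions, and maximal
because α changes between the end of a run and the head of the next. The disjunction lets either
endpoint be the known member. -/
lemma mem_run_iff {l : List (Fin n)} (hl : l ∈ runs α) {i j : Fin n} (hij : i ≤ j) :
    (i ∈ l ∧ j ∈ l) ↔ (i ∈ l ∨ j ∈ l) ∧ ∀ m, i ≤ m → m ≤ j → α m = α j := by
  obtain ⟨L₁, L₂, hL⟩ := List.append_of_mem hl
  have hflat : L₁.flatten ++ (l ++ L₂.flatten) = List.finRange n := by
    rw [← flatten_runs α, hL]
    simp
  have hsort : (L₁.flatten ++ (l ++ L₂.flatten)).Pairwise (· < ·) := by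
    rw [hflat]
    exact List.pairwise_lt_finRange n
  obtain ⟨hs₁, hs₂, hlt₁⟩ := List.pairwise_append.1 hsort
  obtain ⟨hs₃, hs₄, hlt₂⟩ := List.pairwise_append.1 hs₂
  have hmem : ∀ m, m ∈ L₁.flatten ∨ m ∈ l ∨ m ∈ L₂.flatten := by
    intro m
    rw [← List.mem_append, ← List.mem_append, hflat]
    exact List.mem_finRange m
  have hchain := List.isChain_getLast_head_splitBy (fun i j => α i == α j) (List.finRange n)
  change (runs α).IsChain _ at hchain
  constructor
  · rintro ⟨hi, hj⟩
    refine ⟨.inl hi, fun m him hmj => ?_⟩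
    rcases hmem m with hm | hm | hm
    · exact absurd (hlt₁ m hm i (List.mem_append_left _ hi)) (not_lt.2 him)
    · exact eq_of_mem_run hl hm hj
    · exact absurd (hlt₂ j hj m hm) (not_lt.2 hmj)
  · rintro ⟨h, hall⟩
    by_contra hcon
    rcases h with hi | hj
    · have hj : j ∉ l := fun hj => hcon ⟨hi, hj⟩
      have hj₂ : j ∈ L₂.flatten := by
        rcases hmem j with h | h | h
        · exact absurd (hlt₁ j h i (List.mem_append_left _ hi)) (not_lt.2 hij)
        · exact absurd h hj
        · exact h
      cases L₂ with
      | nil => simp at hj₂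
      | cons l₂ L₂ =>
        obtain ⟨hne, hne₂, hrel⟩ := hchain.rel_of_infix (a := l) (b := l₂)
          ⟨L₁, L₂, by rw [hL]; simp⟩
        rw [beq_eq_false_iff_ne] at hrel
        have hhead : l₂.head hne₂ ∈ (l₂ :: L₂).flatten := by
          rw [List.flatten_cons]
          exact List.mem_append_left _ (List.head_mem hne₂)
        -- The head of the next run lies between i and j, so constancy of α there contradicts the
        -- change of value.
        have hle : l₂.head hne₂ ≤ j := by
          rw [List.flatten_cons, ← List.cons_head_tail hne₂, List.cons_append] at hs₄ hj₂
          rcases List.mem_cons.1 hj₂ with rfl | hj₂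
          · exact le_rfl
          · exact ((List.pairwise_cons.1 hs₄).1 _ hj₂).le
        apply hrel
        rw [eq_of_mem_run hl (List.getLast_mem hne) hi, hall i le_rfl hij,
          hall _ (hlt₂ i hi _ hhead).le hle]
    · have hi : i ∉ l := fun hi => hcon ⟨hi, hj⟩
      have hi₁ : i ∈ L₁.flatten := by
        rcases hmem i with h | h | h
        · exact h
        · exact absurd h hi
        · exact absurd (hlt₂ j hj i h) (not_lt.2 hij)
      rcases List.eq_nil_or_concat L₁ with rfl | ⟨L₁, l₁, rfl⟩
      · simp at hi₁
      · rw [List.concat_eq_append] at *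
        obtain ⟨hne₁, hne, hrel⟩ := hchain.rel_of_infix (a := l₁) (b := l)
          ⟨L₁, L₂, by rw [hL]; simp⟩
        rw [beq_eq_false_iff_ne] at hrel
        have hflat₁ : (L₁ ++ [l₁]).flatten = (L₁.flatten ++ l₁.dropLast) ++ [l₁.getLast hne₁] := by
          rw [List.append_assoc, List.dropLast_append_getLast]
          simp
        have hlast : l₁.getLast hne₁ ∈ (L₁ ++ [l₁]).flatten := by
          rw [hflat₁]
          simp
        have hle : i ≤ l₁.getLast hne₁ := by
          rw [hflat₁] at hs₁ hi₁
          rcases List.mem_append.1 hi₁ with hi₁ | hi₁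
          · exact ((List.pairwise_append.1 hs₁).2.2 _ hi₁ _ (by simp)).le
          · exact (List.mem_singleton.1 hi₁).le
        apply hrel
        rw [eq_of_mem_run hl (List.head_mem hne) hj, hall _ hle
          (hlt₁ _ hlast j (List.mem_append_left _ hj)).le]

end runs

lemma mem_run_iff_ascentRep_eq {k : ℕ} {α : Fin (k + 1) → ℕ} (hα : IsAscentSeq α)
    {l : List (Fin (k + 1))} (hl : l ∈ runs α) {i : Fin (k + 1)} (hi : i ∈ l) (j : Fin (k + 1)) :
    j ∈ l ↔ ascentRep k α j = ascentRep k α i := by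
  rcases le_total i j with hij | hij
  · rw [eq_comm, ascentRep_eq_iff hα hij]
    simpa [hi] using mem_run_iff hl hij
  · rw [ascentRep_eq_iff hα hij]
    simpa [hi] using mem_run_iff hl hij

/-! ### Blocks -/

section blocks

variable {n : ℕ} {X : Type*} [LinearOrder X]

lemma map_runs_mem_orderedSetPartitions (α : Fin n → ℕ) (f : Fin n ≃ X) :
    (runs α).map (fun l => (l.map f).toFinset) ∈ orderedSetPartitions X (runLengthRecord α) := by
  have hnd : (runs α).flatten.Nodup := by
    rw [flatten_runs]
    exact List.nodup_finRange n
  obtain ⟨hnd₁, hnd₂⟩ := List.nodup_flatten.1 hnd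
  refine ⟨?_, ?_, ?_, ?_⟩
  · intro B hB
    obtain ⟨l, hl, rfl⟩ := List.mem_map.1 hB
    obtain ⟨i, hi⟩ := List.exists_mem_of_ne_nil l (ne_nil_of_mem_runs hl)
    exact ⟨f i, by simpa using hi⟩
  · rw [List.pairwise_map]
    refine hnd₂.imp fun {l l'} h => ?_
    rw [Finset.disjoint_left]
    simp only [List.mem_toFinset, List.mem_map]
    rintro _ ⟨i, hi, rfl⟩ ⟨j, hj, hji⟩
    obtain rfl := f.injective hji
    exact h hi hj
  · intro x
    obtain ⟨l, hl, hi⟩ := exists_mem_runs α (f.symm x)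
    exact ⟨_, List.mem_map_of_mem hl, by simpa using ⟨_, hi, f.apply_symm_apply x⟩⟩
  · rw [List.map_map, runLengthRecord]
    refine List.map_congr_left fun l hl => ?_
    rw [Function.comp_apply, List.toFinset_card_of_nodup ((hnd₁ l hl).map f.injective),
      List.length_map]

/-- The word of an ordered set partition whose block sizes are the run lengths of `α` is an
enumeration of the set that maps the runs of `α` to the blocks. -/
lemma exists_equiv_blockWord {α : Fin n → ℕ} {χ : List (Finset X)}
    (hχ : χ ∈ orderedSetPartitions X (runLengthRecord α)) :
    ∃ f : Fin n ≃ X, (∀ i : Fin n, (blockWord χ)[(i : ℕ)]? = some (f i)) ∧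
      χ = (runs α).map (fun l => (l.map f).toFinset) := by
  obtain ⟨-, hdisj, hcov, hcard⟩ := hχ
  have hflat : blockWord χ = (χ.map fun B => B.sort (· ≤ ·)).flatten := by
    rw [blockWord, List.flatMap_def]
  have hlens : (χ.map fun B => B.sort (· ≤ ·)).map List.length = (runs α).map List.length := by
    rw [List.map_map, ← runLengthRecord, ← hcard]
    exact List.map_congr_left fun B _ => by simp
  have hlen : (blockWord χ).length = n := by
    rw [hflat, List.length_flatten, hlens, ← List.length_flatten, flatten_runs,
      List.length_finRange]
  have hnd : (blockWord χ).Nodup := by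
    rw [hflat, List.nodup_flatten]
    constructor
    · intro l hl
      obtain ⟨B, -, rfl⟩ := List.mem_map.1 hl
      exact Finset.sort_nodup B _
    · rw [List.pairwise_map]
      refine hdisj.imp fun {B C} h => ?_
      intro x hx hx'
      rw [Finset.mem_sort] at hx hx'
      exact Finset.disjoint_left.1 h hx hx'
  have hmem : ∀ x, x ∈ blockWord χ := by
    intro x
    obtain ⟨B, hB, hx⟩ := hcov x
    exact List.mem_flatMap.2 ⟨B, hB, (Finset.mem_sort _).2 hx⟩
  have hbij : Function.Bijective fun i : Fin n => (blockWord χ)[(i : ℕ)]'(by omega) := by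
    constructor
    · intro i j hij
      exact Fin.ext (hnd.getElem_inj_iff.1 hij)
    · intro x
      obtain ⟨i, hi, rfl⟩ := List.getElem_of_mem (hmem x)
      exact ⟨⟨i, by omega⟩, rfl⟩
  refine ⟨Equiv.ofBijective _ hbij, fun i => ?_, ?_⟩
  · rw [List.getElem?_eq_getElem (by omega)]
    rfl
  · set f := Equiv.ofBijective _ hbij with hf
    have hword : (List.finRange n).map f = blockWord χ := by
      apply List.ext_getElem (by simp [hlen])
      intro i h₁ h₂
      simp [hf]
    -- Two lists of lists agree if their concatenations and their lists of lengths do.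
    have key : (χ.map fun B => B.sort (· ≤ ·)) = (runs α).map (List.map f) := by
      rw [List.eq_iff_flatten_eq, ← hflat, ← List.map_flatten, flatten_runs, hword, hlens]
      simp
    have := congrArg (List.map List.toFinset) key
    rw [List.map_map, List.map_map] at this
    refine Eq.trans ?_ this
    conv_lhs => rw [← List.map_id χ]
    exact List.map_congr_left fun B _ => by simp

/-! ### Reading off a pair, and the two maps as mutual inverses. -/

lemma madMap_apply_iff {m : (Fin n → ℕ) × List (Finset X)} {f : Fin n ≃ X}
    (hf : ∀ i : Fin n, (blockWord m.2)[(i : ℕ)]? = some (f i)) (i j : Fin n) :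
    madMap m (f i) (f j) ↔ i = j ∨ ascentPoset n m.1 i j := by
  simp only [madMap, hf, Option.some.injEq, f.injective.eq_iff]
  constructor
  · rintro (h | ⟨i', j', rfl, rfl, h⟩)
    · exact .inl h
    · exact .inr h
  · rintro (h | h)
    · exact .inl h
    · exact .inr ⟨i, j, rfl, rfl, h⟩

lemma readsOff_madMap {m : (Fin n → ℕ) × List (Finset X)} (hm : m ∈ Mad n X) :
    ReadsOff (madMap m) m := by
  obtain ⟨f, hf, hχ⟩ := exists_equiv_blockWord hm.2
  exact ⟨hm.1, f, madMap_apply_iff hf, hχ⟩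

lemma ReadsOff.mem_mad {r : X → X → Prop} {m : (Fin n → ℕ) × List (Finset X)}
    (h : ReadsOff r m) : m ∈ Mad n X := by
  obtain ⟨hα, f, -, hχ⟩ := h
  refine ⟨hα, ?_⟩
  rw [hχ]
  exact map_runs_mem_orderedSetPartitions m.1 f

variable [Fintype X]

/-- The right-hand side does not involve `f`: a block is a fibre of `c`. -/
lemma toFinset_map_run {k : ℕ} {α : Fin (k + 1) → ℕ} (hα : IsAscentSeq α)
    {f : Fin (k + 1) ≃ X} {c : X → ℕ × ℕ} (hc : ∀ i, c (f i) = ascentRep k α i)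
    {l : List (Fin (k + 1))} (hl : l ∈ runs α) {i : Fin (k + 1)} (hi : i ∈ l) :
    (l.map f).toFinset = Finset.univ.filter fun x => c x = ascentRep k α i := by
  ext x
  obtain ⟨j, rfl⟩ := f.surjective x
  simp [hc, mem_run_iff_ascentRep_eq hα hl hi]

lemma ReadsOff.exists_rep {k : ℕ} {r : X → X → Prop} {m : (Fin (k + 1) → ℕ) × List (Finset X)}
    (h : ReadsOff r m) :
    ∃ (f : Fin (k + 1) ≃ X) (c : X → ℕ × ℕ) (ℓ s : ℕ),
      IsFishburnRep (fun x y => r x y ∧ x ≠ y) c ℓ s ∧ (∀ i, c (f i) = ascentRep k m.1 i) ∧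
        m.2 = (runs m.1).map (fun l => (l.map f).toFinset) ∧
          ∀ x y, r x y ↔ x = y ∨ (c x).2 < (c y).1 := by
  obtain ⟨hα, f, hf, hχ⟩ := h
  have hrep := isFishburnRep_ascentRep hα
  have hr : ∀ x y, r x y ↔ x = y ∨ ascentPoset (k + 1) m.1 (f.symm x) (f.symm y) := by
    intro x y
    simpa using hf (f.symm x) (f.symm y)
  have hlt : (fun x y => r x y ∧ x ≠ y) =
      fun x y => ascentPoset (k + 1) m.1 (f.symm x) (f.symm y) := by
    funext x y
    rw [hr, eq_iff_iff]
    constructor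
    · rintro ⟨h | h, hne⟩
      · exact absurd h hne
      · exact h
    · intro h
      refine ⟨.inr h, ?_⟩
      rintro rfl
      rw [hrep.lt_iff] at h
      exact absurd (hrep.fst_le_snd _) (not_le.2 h)
  refine ⟨f, ascentRep k m.1 ∘ f.symm, asc m.1 (k + 1), m.1 (Fin.last k), ?_, fun i => by simp, hχ, fun x y => ?_⟩
  · rw [hlt]
    exact hrep.comp_equiv f.symm
  · rw [hr, hrep.lt_iff]
    rfl

lemma ReadsOff.unique {r : X → X → Prop} {m m' : (Fin n → ℕ) × List (Finset X)}
    (h : ReadsOff r m) (h' : ReadsOff r m') : m = m' := by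
  -- The empty poset is treated apart: a Fishburn multiset contains (s, ℓ), so it is nonempty.
  cases n with
  | zero =>
    obtain ⟨-, f, -, hχ⟩ := h
    obtain ⟨-, f', -, hχ'⟩ := h'
    refine Prod.ext (Subsingleton.elim _ _) ?_
    rw [hχ, hχ']
    simp [runs]
  | succ k =>
    obtain ⟨f, c, ℓ, s, hc, hcf, hχ, -⟩ := h.exists_rep
    obtain ⟨f', c', ℓ', s', hc', hcf', hχ', -⟩ := h'.exists_rep
    obtain rfl := hc.rep_unique hc'
    obtain ⟨α, χ⟩ := m
    obtain ⟨β, χ'⟩ := m'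
    dsimp only at *
    obtain rfl : α = β := by
      apply eq_of_map_ascentRep_eq h.1 h'.1
      rw [← funext hcf, ← funext hcf']
      exact (Multiset.map_univ_val_comp_equiv f c).trans
        (Multiset.map_univ_val_comp_equiv f' c).symm
    congr 1
    rw [hχ, hχ']
    refine List.map_congr_left fun l hl => ?_
    obtain ⟨i, hi⟩ := List.exists_mem_of_ne_nil l (ne_nil_of_mem_runs hl)
    rw [toFinset_map_run h.1 hcf hl hi, toFinset_map_run h.1 hcf' hl hi]

lemma exists_readsOff (hX : Fintype.card X = n) {r : X → X → Prop}
    (hr : r ∈ TwoPlusTwoFreePosets X) :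
    ∃ m : (Fin n → ℕ) × List (Finset X), ReadsOff r m := by
  cases n with
  | zero =>
    have := Fintype.card_eq_zero_iff.1 hX
    exact ⟨(Fin.elim0, _), fun i => i.elim0, Equiv.equivOfIsEmpty _ _, fun i => i.elim0, rfl⟩
  | succ k =>
    have : Nonempty X := Fintype.card_pos_iff.1 (by omega)
    obtain ⟨c, ℓ, s, hc⟩ := exists_isFishburnRep_of_mem hr
    obtain ⟨α, hα, hαc⟩ := exists_map_ascentRep_eq hc.fishburn
      (by rw [Multiset.card_map, Finset.card_val, Finset.card_univ, hX])
    obtain ⟨f, hf⟩ := Multiset.exists_equiv_of_map_univ_val_eq hαc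
    refine ⟨(α, (runs α).map fun l => (l.map f).toFinset), hα, f, fun i j => ?_, rfl⟩
    have hij := hc.lt_iff (f i) (f j)
    rw [hf, hf, ← (isFishburnRep_ascentRep hα).lt_iff, Ne, f.injective.eq_iff] at hij
    rw [← hij]
    by_cases h : i = j
    · subst h
      simpa using hr.1.refl (f i)
    · simp [h]

lemma ReadsOff.exists_block_iff {r : X → X → Prop} {m : (Fin n → ℕ) × List (Finset X)}
    (h : ReadsOff r m) (x y : X) : (∃ B ∈ m.2, x ∈ B ∧ y ∈ B) ↔ Indistinguishable r x y := by
  cases n with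
  | zero =>
    obtain ⟨-, f, -⟩ := h
    exact (f.symm x).elim0
  | succ k =>
    obtain ⟨f, c, ℓ, s, hc, hcf, hχ, -⟩ := h.exists_rep
    refine Iff.trans ?_ (hc.eq_iff x y)
    rw [hχ]
    constructor
    · rintro ⟨B, hB, hx, hy⟩
      obtain ⟨l, hl, rfl⟩ := List.mem_map.1 hB
      obtain ⟨i, hi⟩ := List.exists_mem_of_ne_nil l (ne_nil_of_mem_runs hl)
      rw [toFinset_map_run h.1 hcf hl hi, Finset.mem_filter] at hx hy
      rw [hx.2, hy.2]
    · intro hxy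
      obtain ⟨l, hl, hi⟩ := exists_mem_runs m.1 (f.symm x)
      refine ⟨_, List.mem_map_of_mem hl, ?_⟩
      rw [toFinset_map_run h.1 hcf hl hi, ← hcf, f.apply_symm_apply]
      simp [hxy]

lemma ReadsOff.madMap_eq {r : X → X → Prop} {m : (Fin n → ℕ) × List (Finset X)}
    (h : ReadsOff r m) : madMap m = r := by
  cases n with
  | zero =>
    obtain ⟨-, f, -⟩ := h
    funext x
    exact (f.symm x).elim0
  | succ k =>
    obtain ⟨f, c, ℓ, s, hc, hcf, hχ, hr⟩ := h.exists_rep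
    obtain ⟨g, hg, hχg⟩ := exists_equiv_blockWord h.mem_mad.2
    -- The labelling `g` from the word may differ from the isomorphism `f`, but both map each run to
    -- the same block, on which `c` is constant.
    have hcg : ∀ i, c (g i) = ascentRep k m.1 i := by
      intro i
      obtain ⟨l, hl, hi⟩ := exists_mem_runs m.1 i
      have hB := List.map_inj_left.1 (hχg.symm.trans hχ) l hl
      have hgi : g i ∈ (l.map g).toFinset := by simpa using hi
      rw [hB, toFinset_map_run h.1 hcf hl hi, Finset.mem_filter] at hgi
      exact hgi.2
    funext x y
    obtain ⟨i, rfl⟩ := g.surjective x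
    obtain ⟨j, rfl⟩ := g.surjective y
    rw [eq_iff_iff, madMap_apply_iff hg, hr, hcg, hcg, g.injective.eq_iff,
      (isFishburnRep_ascentRep h.1).lt_iff]

lemma madMap_mem_twoPlusTwoFreePosets {m : (Fin n → ℕ) × List (Finset X)} (hm : m ∈ Mad n X) :
    madMap m ∈ TwoPlusTwoFreePosets X := by
  have h := readsOff_madMap hm
  cases n with
  | zero =>
    obtain ⟨-, f, -⟩ := h
    exact mem_twoPlusTwoFreePosets_of_pairs (c := fun _ => (0, 0))
      (fun x => (f.symm x).elim0) fun x => (f.symm x).elim0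
  | succ k =>
    obtain ⟨f, c, ℓ, s, hc, -, -, hr⟩ := h.exists_rep
    exact mem_twoPlusTwoFreePosets_of_pairs hc.fst_le_snd hr

lemma readsOff_iff_eq_readOff (hX : Fintype.card X = n) {r : X → X → Prop}
    (hr : r ∈ TwoPlusTwoFreePosets X) (m : (Fin n → ℕ) × List (Finset X)) :
    ReadsOff r m ↔ m = readOff r := by
  have hspec : ReadsOff r (readOff (n := n) r) := Classical.epsilon_spec (exists_readsOff hX hr)
  exact ⟨fun h => h.unique hspec, fun h => h ▸ hspec⟩

end blocks

/-! ### The bijection and its inverse. -/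

theorem theorem18 (n : ℕ) :
    -- `φ` is a bijection from `Mad_n` to the `(2+2)`-free posets on `{1, …, n}`
    Set.BijOn (madMap (n := n) (X := Finset.Icc 1 n))
      (Mad n (Finset.Icc 1 n)) (TwoPlusTwoFreePosets (Finset.Icc 1 n)) ∧
    -- the reading-off map `π` is well defined: exactly one pair can be read off from each poset
    (∀ r ∈ TwoPlusTwoFreePosets (Finset.Icc 1 n),
      ∀ m : (Fin n → ℕ) × List (Finset (Finset.Icc 1 n)), ReadsOff r m ↔ m = readOff r) ∧
    -- it maps the `(2+2)`-free posets to `Mad_n`, and its blocks are the classes of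
    -- indistinguishable elements
    Set.MapsTo (readOff (n := n) (X := Finset.Icc 1 n))
      (TwoPlusTwoFreePosets (Finset.Icc 1 n)) (Mad n (Finset.Icc 1 n)) ∧
    (∀ r ∈ TwoPlusTwoFreePosets (Finset.Icc 1 n), ∀ x y : Finset.Icc 1 n,
      (∃ B ∈ (readOff (n := n) r).2, x ∈ B ∧ y ∈ B) ↔ Indistinguishable r x y) ∧
    -- `π` is the inverse of `φ`
    Set.InvOn (readOff (n := n) (X := Finset.Icc 1 n)) (madMap (n := n) (X := Finset.Icc 1 n))
      (Mad n (Finset.Icc 1 n)) (TwoPlusTwoFreePosets (Finset.Icc 1 n)) := by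
  have hX : Fintype.card (Finset.Icc 1 n) = n := by simp
  have hspec : ∀ r ∈ TwoPlusTwoFreePosets (Finset.Icc 1 n), ReadsOff r (readOff (n := n) r) :=
    fun r hr => (readsOff_iff_eq_readOff hX hr _).2 rfl
  have hmad : Set.MapsTo (madMap (n := n) (X := Finset.Icc 1 n))
      (Mad n (Finset.Icc 1 n)) (TwoPlusTwoFreePosets (Finset.Icc 1 n)) :=
    fun m hm => madMap_mem_twoPlusTwoFreePosets hm
  have hread : Set.MapsTo (readOff (n := n) (X := Finset.Icc 1 n))
      (TwoPlusTwoFreePosets (Finset.Icc 1 n)) (Mad n (Finset.Icc 1 n)) :=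
    fun r hr => (hspec r hr).mem_mad
  have hinv : Set.InvOn (readOff (n := n) (X := Finset.Icc 1 n))
      (madMap (n := n) (X := Finset.Icc 1 n))
      (Mad n (Finset.Icc 1 n)) (TwoPlusTwoFreePosets (Finset.Icc 1 n)) :=
    ⟨fun m hm => ((readsOff_iff_eq_readOff hX (hmad hm) m).1 (readsOff_madMap hm)).symm,
      fun r hr => (hspec r hr).madMap_eq⟩
  exact ⟨hinv.bijOn hmad hread, fun r hr m => readsOff_iff_eq_readOff hX hr m, hread,
    fun r hr x y => (hspec r hr).exists_block_iff x y, hinv⟩
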